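/- Throughout, manifolds are connected and of class $C^4$, and pseudo-Riemannian metrics (of arbitrary signature) are of class $C^3$. Let $(M_*,g_*)$ be an $m$-dimensional pseudo-Riemannian manifold, $m\ge 2$, let $\varepsilon\in\{1,-1\}$, let $J\subseteq\mathbb{R}$ be an open interval (for instance $J=\mathbb{R}$), and let $f:J\times M_*\to\mathbb{R}$, $(t,x)\mapsto f(t,x)$, be a non-constant function of class $C^4$ (zeros are allowed). Suppose that the metric $\overline g=f^{-2}(\varepsilon\,dt^2+g_*)$, defined on the open set $\{f\neq 0\}\subseteq J\times M_*$, is Einstein, i.e. $\overline{\mathrm{Ric}}=\overline\lambda\,\overline g$ there for some function $\overline\lambda$. Then one of the following cases occurs: 1. $f$ depends only on $t$. 2. $f$ depends only on $x$. 3. There are non-constant functions $a:J\to\mathbb{R}$ and $b:M_*\to\mathbb{R}$ of class $C^4$ with $f(t,x)=a(t)+b(x)$ for all $t\in J$, $x\in M_*$, and there are real constants $k_*$ and $c$ such that $(M_*,g_*)$ is an Einstein space with constant normalized scalar curvature $k_*$, i.e. $\mathrm{Ric}_*=(m-1)\,k_*\,g_*$ (with $k_*$ constant even if $m=2$), the function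 $a$ satisfies $a''=\varepsilon k_*a+c$ on $J$, and the function $b$ satisfies $\nabla_*^2b=\frac{\Delta_*b}{m}\,g_*$ on $M_*$, where $\nabla_*^2b$ is the Hessian and $\Delta_*b$ its $g_*$-trace, the Laplacian. -/

import Mathlib

open scoped Manifold ContDiff

set_option maxSynthPendingDepth 3

noncomputable section

namespace PseudoRiem

/-! ### Local formulas on a vector space

`G` is a field of bilinear forms on the finite-dimensional space `E` (a metric in a chart). -/

section Local

variable {E : Type*} [NormedAddCommGroup E] [NormedSpace ℝ E]

/-- Christoffel symbols of the first kind,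
`christoffel₁ G p u v w = (D_u G(v,w) + D_v G(u,w) - D_w G(u,v)) / 2` at `p`. -/
def christoffel₁ (G : E → E →L[ℝ] E →L[ℝ] ℝ) (p : E) : E →L[ℝ] E →L[ℝ] E →L[ℝ] ℝ :=
  let D : E →L[ℝ] E →L[ℝ] E →L[ℝ] ℝ := fderiv ℝ G p
  let S : (E →L[ℝ] E →L[ℝ] ℝ) →L[ℝ] (E →L[ℝ] E →L[ℝ] ℝ) :=
    (ContinuousLinearMap.flipₗᵢ ℝ E E ℝ).toContinuousLinearEquiv.toContinuousLinearMap
  (1 / 2 : ℝ) • (D + D.flip - S.comp D.flip)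

theorem christoffel₁_apply (G : E → E →L[ℝ] E →L[ℝ] ℝ) (p u v w : E) :
    christoffel₁ G p u v w =
      (1 / 2 : ℝ) * (fderiv ℝ G p u v w + fderiv ℝ G p v u w - fderiv ℝ G p w u v) := by
  simp [christoffel₁]

/-- Christoffel symbols (of the second kind): the vector `christoffel G p u v` is the one whose
`G p`-product with every `w` is `christoffel₁ G p u v w`. -/
def christoffel (G : E → E →L[ℝ] E →L[ℝ] ℝ) (p : E) : E →L[ℝ] E →L[ℝ] E :=
  (ContinuousLinearMap.compL ℝ E (E →L[ℝ] ℝ) E (ContinuousLinearMap.inverse (G p))).comp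
    (christoffel₁ G p)

/-- The curvature tensor `R(u,v)w` of the Levi-Civita connection of `G`, where
`R(X,Y)Z = ∇_X ∇_Y Z - ∇_Y ∇_X Z - ∇_[X,Y] Z`. -/
def curvature (G : E → E →L[ℝ] E →L[ℝ] ℝ) (p u v w : E) : E :=
  fderiv ℝ (christoffel G) p u v w - fderiv ℝ (christoffel G) p v u w +
    christoffel G p u (christoffel G p v w) - christoffel G p v (christoffel G p u w)

/-- The Ricci tensor `Ric(u,v) = trace (z ↦ R(z,u)v)` of `G`. -/
def chartRicci (G : E → E →L[ℝ] E →L[ℝ] ℝ) (p u v : E) : ℝ :=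
  LinearMap.trace ℝ E
    { toFun := fun z => curvature G p z u v
      map_add' := fun z z' => by simp [curvature]; abel
      map_smul' := fun c z => by simp [curvature, smul_sub, smul_add] }

/-- The Hessian `∇²b(u,v) = D²b(u,v) - Db(Γ(u,v))` of the function `b` with respect to `G`. -/
def chartHessian (G : E → E →L[ℝ] E →L[ℝ] ℝ) (b : E → ℝ) (p : E) : E →L[ℝ] E →L[ℝ] ℝ :=
  fderiv ℝ (fderiv ℝ b) p -
    (ContinuousLinearMap.compL ℝ E E ℝ (fderiv ℝ b p)).comp (christoffel G p)

/-- The Laplacian `Δb = div (grad b)`: the trace of the endomorphism `v ↦ ∇_v grad b` that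
corresponds to the Hessian through `G`. -/
def chartLaplacian (G : E → E →L[ℝ] E →L[ℝ] ℝ) (b : E → ℝ) (p : E) : ℝ :=
  LinearMap.trace ℝ E
    ((ContinuousLinearMap.inverse (G p)).comp (chartHessian G b p) : E →L[ℝ] E)

end Local

/-! ### Tensors on a manifold -/

section Manifold

variable {E : Type*} [NormedAddCommGroup E] [NormedSpace ℝ E]
  {H : Type*} [TopologicalSpace H] (I : ModelWithCorners ℝ E H)
  (M : Type*) [TopologicalSpace M] [ChartedSpace H M]

/-- Fields of (continuous) bilinear forms on the tangent spaces, i.e. `(0,2)`-tensor fields. -/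
abbrev TwoTensor := ∀ x : M, TangentSpace I x →L[ℝ] TangentSpace I x →L[ℝ] ℝ

variable {I M}

/-- The expression of a `(0,2)`-tensor field in the chart at `x₀`: the pullback of `g` under the
inverse of the chart. -/
def chartRep (g : TwoTensor I M) (x₀ : M) (y : E) : E →L[ℝ] E →L[ℝ] ℝ :=
  let A : E →L[ℝ] TangentSpace I ((extChartAt I x₀).symm y) :=
    mfderiv 𝓘(ℝ, E) I (extChartAt I x₀).symm y
  (A.precomp ℝ).comp ((g ((extChartAt I x₀).symm y)).comp A)

/-- `g` is a pseudo-Riemannian metric of class `C^r`: symmetric, nondegenerate (of arbitrary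
signature), with components of class `C^r` in charts. -/
structure IsPseudoRiemannianMetric (r : ℕ∞ω) (g : TwoTensor I M) : Prop where
  symm : ∀ (x : M) (u v : TangentSpace I x), g x u v = g x v u
  nondegenerate : ∀ (x : M) (u : TangentSpace I x), (∀ v, g x u v = 0) → u = 0
  contDiffOn : ∀ x₀ : M, ContDiffOn ℝ r (chartRep g x₀) (extChartAt I x₀).target

/-- The Ricci tensor at `x`, computed in the chart at `x`, through which the tangent space
at `x` is identified with the model space `E`. -/
def ricci (g : TwoTensor I M) (x : M) (u v : TangentSpace I x) : ℝ :=
  chartRicci (chartRep g x) (extChartAt I x x) u v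

/-- The Hessian `∇²b` at `x` of a function with respect to the metric `g`. -/
def hessian (g : TwoTensor I M) (b : M → ℝ) (x : M) (u v : TangentSpace I x) : ℝ :=
  chartHessian (chartRep g x) (b ∘ (extChartAt I x).symm) (extChartAt I x x) u v

/-- The Laplacian `Δb` at `x` of a function with respect to the metric `g`. -/
def laplacian (g : TwoTensor I M) (b : M → ℝ) (x : M) : ℝ :=
  chartLaplacian (chartRep g x) (b ∘ (extChartAt I x).symm) (extChartAt I x x)

/-- The metric `g` is Einstein on the open set `U`: `Ric = lam • g` with a factor `lam`, which is
required to be constant in dimension two (constant Gaussian curvature). -/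
def IsEinsteinOn (g : TwoTensor I M) (U : Set M) : Prop :=
  ∃ lam : M → ℝ, (∀ x ∈ U, ∀ u v : TangentSpace I x, ricci g x u v = lam x * g x u v) ∧
    (Module.finrank ℝ E = 2 → ∀ x ∈ U, ∀ y ∈ U, lam x = lam y)

/-- `g` is an Einstein metric with constant normalized scalar curvature `k`:
`Ric = (n - 1) k g`, where `n` is the dimension. -/
def IsEinsteinWith (g : TwoTensor I M) (k : ℝ) : Prop :=
  ∀ (x : M) (u v : TangentSpace I x),
    ricci g x u v = ((Module.finrank ℝ E : ℝ) - 1) * k * g x u v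

/-- The pullback of a `(0,2)`-tensor field under a map. -/
def pullback {E' : Type*} [NormedAddCommGroup E'] [NormedSpace ℝ E']
    {H' : Type*} [TopologicalSpace H'] {I' : ModelWithCorners ℝ E' H'}
    {M' : Type*} [TopologicalSpace M'] [ChartedSpace H' M']
    (F : M' → M) (g : TwoTensor I M) : TwoTensor I' M' := fun p =>
  ((mfderiv I' I F p).precomp ℝ).comp ((g (F p)).comp (mfderiv I' I F p))

/-- The metric `dt²` on the real line. -/
def dtSq : TwoTensor 𝓘(ℝ, ℝ) ℝ := fun _ => ContinuousLinearMap.mul ℝ ℝ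

/-- The metric `ε dt² + g` on the product `ℝ × M`. -/
def cylinderMetric (ε : ℝ) (g : TwoTensor I M) : TwoTensor (𝓘(ℝ, ℝ).prod I) (ℝ × M) := fun p =>
  ε • pullback (I' := 𝓘(ℝ, ℝ).prod I) Prod.fst dtSq p +
    pullback (I' := 𝓘(ℝ, ℝ).prod I) Prod.snd g p

/-- The conformally changed metric `f⁻² g` (meaningful where `f ≠ 0`). -/
def conformalChange (f : M → ℝ) (g : TwoTensor I M) : TwoTensor I M := fun x =>
  (f x ^ 2)⁻¹ • g x

end Manifold

end PseudoRiem

end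

open scoped Topology

noncomputable section

namespace PseudoRiem

section Local

variable {E : Type*} [NormedAddCommGroup E] [NormedSpace ℝ E]

theorem chartRicci_congr {G G' : E → E →L[ℝ] E →L[ℝ] ℝ} {p : E} (h : G =ᶠ[𝓝 p] G') (u v : E) :
    chartRicci G p u v = chartRicci G' p u v := by
  have h1 : ∀ q, G =ᶠ[𝓝 q] G' → christoffel G q = christoffel G' q := fun q hq => by
    simp only [christoffel, christoffel₁, hq.fderiv_eq, hq.eq_of_nhds]
  have h2 : christoffel G =ᶠ[𝓝 p] christoffel G' :=
    h.eventually_nhds.mono fun q hq => h1 q hq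
  have h3 : ∀ z, curvature G p z u v = curvature G' p z u v := fun z => by
    simp only [curvature, h2.fderiv_eq, h2.eq_of_nhds]
  simp only [chartRicci, h3]

theorem apply_christoffel {G : E → E →L[ℝ] E →L[ℝ] ℝ} {p : E} (h : (G p).IsInvertible) (u v : E) :
    G p (christoffel G p u v) = christoffel₁ G p u v := by
  simp [christoffel, h.self_apply_inverse]

theorem christoffel_eq_of {G : E → E →L[ℝ] E →L[ℝ] ℝ} {p : E} (h : (G p).IsInvertible) {u v X : E}
    (hX : ∀ w, G p X w = christoffel₁ G p u v w) : christoffel G p u v = X := by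
  apply h.injective
  rw [apply_christoffel h]
  ext w
  exact (hX w).symm

theorem fderiv_symm {G : E → E →L[ℝ] E →L[ℝ] ℝ} {p : E} (hG : DifferentiableAt ℝ G p)
    (hs : ∀ᶠ q in 𝓝 p, ∀ v w, G q v w = G q w v) (u v w : E) :
    fderiv ℝ G p u v w = fderiv ℝ G p u w v := by
  have h1 : ∀ v w, HasFDerivAt (fun q => G q v w)
      (((fderiv ℝ G p).flip v).flip w) p := fun v w => by
    have := (hG.hasFDerivAt.clm_apply (hasFDerivAt_const v p)).clm_apply (hasFDerivAt_const w p)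
    refine this.congr_fderiv ?_
    ext x; simp
  have h2 : (fun q => G q v w) =ᶠ[𝓝 p] fun q => G q w v := hs.mono fun q hq => hq v w
  have := (h1 v w).unique ((h1 w v).congr_of_eventuallyEq h2)
  simpa using congr($this u)

theorem christoffel_symm {G : E → E →L[ℝ] E →L[ℝ] ℝ} {p : E} (hG : DifferentiableAt ℝ G p)
    (hs : ∀ᶠ q in 𝓝 p, ∀ v w, G q v w = G q w v) (u v : E) :
    christoffel G p u v = christoffel G p v u := by
  have : christoffel₁ G p u v = christoffel₁ G p v u := by
    ext w
    rw [christoffel₁_apply, christoffel₁_apply, fderiv_symm hG hs w u v]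
    ring
  simp [christoffel, this]

/-- The metric is parallel for its Levi-Civita connection. -/
theorem fderiv_metric_eq {G : E → E →L[ℝ] E →L[ℝ] ℝ} {p : E} (h : (G p).IsInvertible)
    (hG : DifferentiableAt ℝ G p)
    (hs : ∀ᶠ q in 𝓝 p, ∀ v w, G q v w = G q w v) (u v w : E) :
    fderiv ℝ G p u v w = G p (christoffel G p u v) w + G p v (christoffel G p u w) := by
  rw [hs.self_of_nhds v, apply_christoffel h, apply_christoffel h, christoffel₁_apply,
    christoffel₁_apply, fderiv_symm hG hs v u w, fderiv_symm hG hs u w v, fderiv_symm hG hs w u v]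
  ring

variable [FiniteDimensional ℝ E]

theorem eventually_isInvertible {X : Type*} [TopologicalSpace X]
    {G : X → E →L[ℝ] E →L[ℝ] ℝ} {p : X} (h : (G p).IsInvertible) (hG : ContinuousAt G p) :
    ∀ᶠ q in 𝓝 p, (G q).IsInvertible := by
  have := FiniteDimensional.complete ℝ E
  obtain ⟨e, he⟩ := h
  exact hG.eventually (by rw [← he]; exact ContinuousLinearEquiv.nhds e)

theorem differentiableAt_christoffel {G : E → E →L[ℝ] E →L[ℝ] ℝ} {p : E} (h : (G p).IsInvertible)
    (hG : ContDiffAt ℝ 2 G p) : DifferentiableAt ℝ (christoffel G) p := by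
  have := FiniteDimensional.complete ℝ E
  have h1 : DifferentiableAt ℝ (fun q => ContinuousLinearMap.inverse (G q)) p :=
    ((h.contDiffAt_map_inverse (n := 2)).comp p hG).differentiableAt (by norm_num)
  have h2 : DifferentiableAt ℝ (fderiv ℝ G) p :=
    (hG.fderiv_right (m := 1) (by norm_num)).differentiableAt (by norm_num)
  have h3 : DifferentiableAt ℝ (christoffel₁ G) p := by
    unfold christoffel₁
    have h4 : DifferentiableAt ℝ (fun q => (fderiv ℝ G q).flip) p :=
      (ContinuousLinearMap.flipₗᵢ ℝ E E (E →L[ℝ] ℝ)).toContinuousLinearEquiv.differentiableAt.comp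
        p h2
    have h5 := (h2.add h4).sub ((differentiableAt_const
      (ContinuousLinearMap.flipₗᵢ ℝ E E ℝ).toContinuousLinearEquiv.toContinuousLinearMap).clm_comp
        h4)
    exact h5.const_smul (1 / 2 : ℝ)
  exact ((ContinuousLinearMap.compL ℝ E (E →L[ℝ] ℝ) E).differentiableAt.comp p h1).clm_comp h3

end Local

section Conformal

variable {E : Type*} [NormedAddCommGroup E] [NormedSpace ℝ E]

theorem isInvertible_smul {B : E →L[ℝ] E →L[ℝ] ℝ} (h : B.IsInvertible) {c : ℝ} (hc : c ≠ 0) :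
    (c • B).IsInvertible := by
  refine ContinuousLinearMap.IsInvertible.of_inverse (g := c⁻¹ • B.inverse) ?_ ?_
  · ext x; simp [h.self_apply_inverse, hc]
  · ext x; simp [h.inverse_apply_self, hc]

/-- The Christoffel symbols of the conformally changed metric `F⁻² G`. -/
theorem christoffel_conformal {G : E → E →L[ℝ] E →L[ℝ] ℝ} {F : E → ℝ} {p : E}
    (h : (G p).IsInvertible) (hG : DifferentiableAt ℝ G p) (hF : DifferentiableAt ℝ F p)
    (hF0 : F p ≠ 0) (u v : E) :
    christoffel (fun q => (F q ^ 2)⁻¹ • G q) p u v =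
      christoffel G p u v - ((F p)⁻¹ * fderiv ℝ F p u) • v - ((F p)⁻¹ * fderiv ℝ F p v) • u
        + G p u v • (F p)⁻¹ • (G p).inverse (fderiv ℝ F p) := by
  have hinv : ((F p ^ 2)⁻¹ • G p).IsInvertible := isInvertible_smul h (by positivity)
  have h1 : HasFDerivAt (fun q => (F q ^ 2)⁻¹ • G q) _ p :=
    
    ((hasDerivAt_inv (by positivity)).comp_hasFDerivAt p (hF.hasFDerivAt.pow 2)).smul hG.hasFDerivAt
  refine christoffel_eq_of (G := fun q => (F q ^ 2)⁻¹ • G q) hinv fun w => ?_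
  rw [christoffel₁_apply, h1.fderiv]
  simp only [map_add, map_sub, map_smul, add_apply,
    sub_apply, smul_apply, smul_eq_mul,
    ContinuousLinearMap.smulRight_apply, h.self_apply_inverse, apply_christoffel h,
    christoffel₁_apply, Function.comp_apply, nsmul_eq_mul, Nat.cast_ofNat, Nat.add_one_sub_one]
  field_simp
  ring

variable [FiniteDimensional ℝ E]

/-- The Ricci tensor of the conformally changed metric `F⁻² G`. -/
theorem chartRicci_conformal {G : E → E →L[ℝ] E →L[ℝ] ℝ} {F : E → ℝ} {p : E}
    (h : (G p).IsInvertible) (hG : ContDiffAt ℝ 2 G p) (hF : ContDiffAt ℝ 2 F p)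
    (hF0 : F p ≠ 0) (hs : ∀ᶠ q in 𝓝 p, ∀ v w, G q v w = G q w v) :
    ∃ φ : ℝ, ∀ u v, chartRicci (fun q => (F q ^ 2)⁻¹ • G q) p u v =
      chartRicci G p u v + ((Module.finrank ℝ E : ℝ) - 2) * (F p)⁻¹ * chartHessian G F p u v
        + φ * G p u v := by
  have := FiniteDimensional.complete ℝ E
  set H : E → E →L[ℝ] E →L[ℝ] ℝ := fun q => (F q ^ 2)⁻¹ • G q with hH
  set α : E → E →L[ℝ] ℝ := fun q => (F q)⁻¹ • fderiv ℝ F q with hα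
  set a : E → E := fun q => (G q).inverse (α q) with ha
  have hGd : DifferentiableAt ℝ G p := hG.differentiableAt (by norm_num)
  have hFd : DifferentiableAt ℝ F p := hF.differentiableAt (by norm_num)
  have hF2 : DifferentiableAt ℝ (fderiv ℝ F) p :=
    (hF.fderiv_right (m := 1) (by norm_num)).differentiableAt (by norm_num)
  have hαd : DifferentiableAt ℝ α p := (hFd.inv hF0).smul hF2
  have hinvd : DifferentiableAt ℝ (fun q => (G q).inverse) p :=
    ((h.contDiffAt_map_inverse (n := 2)).comp p hG).differentiableAt (by norm_num)
  have had : DifferentiableAt ℝ a p := hinvd.clm_apply hαd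
  have hev : ∀ᶠ q in 𝓝 p, ∀ u v, christoffel H q u v =
      christoffel G q u v - α q u • v - α q v • u + G q u v • a q := by
    filter_upwards [eventually_isInvertible h hG.continuousAt,
      hG.eventually (by norm_num), hF.eventually (by norm_num),
      hF.continuousAt.eventually_ne hF0] with q h1 h2 h3 h4 u v
    rw [hH, christoffel_conformal h1 (h2.differentiableAt (by norm_num))
      (h3.differentiableAt (by norm_num)) h4]
    simp [hα, ha]
  have hinvH : (H p).IsInvertible := isInvertible_smul h (by positivity)
  have hHc : ContDiffAt ℝ 2 H p := ((hF.pow 2).inv (by positivity)).smul hG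
  have hΓ := differentiableAt_christoffel h hG
  have hΓH := differentiableAt_christoffel hinvH hHc
  have hap : ∀ {K : E → E →L[ℝ] E →L[ℝ] E}, DifferentiableAt ℝ K p → ∀ v w,
      HasFDerivAt (fun q => K q v w) (((fderiv ℝ K p).flip v).flip w) p := fun hK v w => by
    refine ((hK.hasFDerivAt.clm_apply (hasFDerivAt_const v p)).clm_apply
      (hasFDerivAt_const w p)).congr_fderiv ?_
    ext x; simp
  have hap' : ∀ {K : E → E →L[ℝ] E →L[ℝ] ℝ}, DifferentiableAt ℝ K p → ∀ v w,
      HasFDerivAt (fun q => K q v w) (((fderiv ℝ K p).flip v).flip w) p := fun hK v w => by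
    refine ((hK.hasFDerivAt.clm_apply (hasFDerivAt_const v p)).clm_apply
      (hasFDerivAt_const w p)).congr_fderiv ?_
    ext x; simp
  have hαv : ∀ v, HasFDerivAt (fun q => α q v) ((fderiv ℝ α p).flip v) p := fun v => by
    refine (hαd.hasFDerivAt.clm_apply (hasFDerivAt_const v p)).congr_fderiv ?_
    ext x; simp
  have hd : ∀ z v w, fderiv ℝ (christoffel H) p z v w =
      fderiv ℝ (christoffel G) p z v w - fderiv ℝ α p z v • w - fderiv ℝ α p z w • v
        + (G p v w • fderiv ℝ a p z + fderiv ℝ G p z v w • a p) := fun z v w => by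
    have e : (fun q => christoffel H q v w) =ᶠ[𝓝 p] fun q =>
      christoffel G q v w - α q v • w - α q w • v + G q v w • a q := hev.mono fun q hq => hq v w
    have := (hap hΓH v w).unique
      (((((hap hΓ v w).sub ((hαv v).smul_const w)).sub ((hαv w).smul_const v)).add
        ((hap' hGd v w).smul had.hasFDerivAt)).congr_of_eventuallyEq e)
    simpa using congr($this z)
  have hpar := fderiv_metric_eq h hGd hs
  have hΓs := christoffel_symm hGd hs
  have hsp := hs.self_of_nhds
  have hga : ∀ w, G p (a p) w = α p w := fun w => by
    simp [ha, h.self_apply_inverse]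
  set B : E →L[ℝ] E →L[ℝ] ℝ := (F p)⁻¹ • chartHessian G F p with hB
  set T : E →L[ℝ] E := fderiv ℝ a p + (christoffel G p).flip (a p) with hT
  have hTv : ∀ z, T z = fderiv ℝ a p z + christoffel G p z (a p) := fun z => by simp [hT]
  have hDα : ∀ z v, fderiv ℝ α p z v =
      B z v + α p (christoffel G p z v) - α p z * α p v := fun z v => by
    have h1 : HasFDerivAt α _ p := 
      ((hasDerivAt_inv hF0).comp_hasFDerivAt p hFd.hasFDerivAt).smul hF2.hasFDerivAt
    rw [h1.fderiv]
    simp [hB, chartHessian, hα]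
    field_simp
    ring
  have hBs : ∀ z v, B z v = B v z := fun z v => by
    have := hF.isSymmSndFDerivAt (by simp) z v
    simp [hB, chartHessian, this, hΓs z v]
  have hDa : ∀ z w, G p (T z) w = B z w - α p z * α p w := fun z w => by
    have e : (fun q => G q (a q) w) =ᶠ[𝓝 p] fun q => α q w := by
      filter_upwards [eventually_isInvertible h hG.continuousAt] with q hq
      simp [ha, hq.self_apply_inverse]
    have h1 : HasFDerivAt (fun q => G q (a q) w) _ p :=
      (hGd.hasFDerivAt.clm_apply had.hasFDerivAt).clm_apply (hasFDerivAt_const w p)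
    have h2 := congr($(h1.unique ((hαv w).congr_of_eventuallyEq e)) z)
    simp [hpar, hga] at h2
    rw [hDα] at h2
    rw [hTv, map_add, add_apply]
    linarith
  have hcurv : ∀ z v w, curvature H p z v w = curvature G p z v w
      - (B z w) • v + (B v w) • z + G p v w • T z - G p z w • T v
      - α p (a p) • (G p v w • z - G p z w • v)
      + (α p z * G p v w - α p v * G p z w) • a p := fun z v w => by
    simp only [curvature, hd, hev.self_of_nhds, hDα, hpar, hTv, map_add, map_sub, map_smul,
      smul_eq_mul]
    rw [hΓs v z, hBs v z, hsp v z, hsp z (a p), hsp v (a p), hga, hga,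
      hsp (christoffel G p z v) w, hsp z (christoffel G p v w), hsp v (christoffel G p z w)]
    module
  refine ⟨LinearMap.trace ℝ E T - ((Module.finrank ℝ E : ℝ) - 2) * α p (a p), fun u v => ?_⟩
  have hlin : chartRicci H p u v = LinearMap.trace ℝ E (
      ({ toFun := fun z => curvature G p z u v
         map_add' := fun z z' => by simp [curvature]; abel
         map_smul' := fun c z => by simp [curvature, smul_sub, smul_add] } : E →ₗ[ℝ] E)
      - ((B.flip v : E →ₗ[ℝ] ℝ)).smulRight u + B u v • LinearMap.id + G p u v • (T : E →ₗ[ℝ] E)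
      - (((G p).flip v : E →L[ℝ] ℝ) : E →ₗ[ℝ] ℝ).smulRight (T u)
      - α p (a p) • (G p u v • LinearMap.id - (((G p).flip v : E →L[ℝ] ℝ) : E →ₗ[ℝ] ℝ).smulRight u)
      + (G p u v • ((α p : E →ₗ[ℝ] ℝ)).smulRight (a p)
        - α p u • (((G p).flip v : E →L[ℝ] ℝ) : E →ₗ[ℝ] ℝ).smulRight (a p))) := by
    unfold chartRicci
    congr 1
    ext z
    simp only [LinearMap.coe_mk, AddHom.coe_mk, hcurv, LinearMap.add_apply, LinearMap.sub_apply,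
      LinearMap.smul_apply, LinearMap.smulRight_apply, LinearMap.id_apply,
      ContinuousLinearMap.coe_coe, ContinuousLinearMap.flip_apply]
    module
  rw [hlin]
  simp only [map_add, map_sub, map_smul, LinearMap.trace_smulRight, LinearMap.trace_id,
    ContinuousLinearMap.coe_coe, ContinuousLinearMap.flip_apply, smul_eq_mul, hDa, hga]
  have hBu : B u v = (F p)⁻¹ * chartHessian G F p u v := by simp [hB]
  rw [← chartRicci, hBu]
  ring

end Conformal

section Cylinder

variable {E : Type*} [NormedAddCommGroup E] [NormedSpace ℝ E]

/-- The metric `ε dt² + G` on `ℝ × E`, for a field `G` of bilinear forms on `E`. -/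
def chartCylinder (ε : ℝ) (G : E → E →L[ℝ] E →L[ℝ] ℝ) (q : ℝ × E) :
    ℝ × E →L[ℝ] ℝ × E →L[ℝ] ℝ :=
  ε • ((ContinuousLinearMap.fst ℝ ℝ E).precomp ℝ).comp
      ((ContinuousLinearMap.mul ℝ ℝ).comp (ContinuousLinearMap.fst ℝ ℝ E)) +
    ((ContinuousLinearMap.snd ℝ ℝ E).precomp ℝ).comp
      ((G q.2).comp (ContinuousLinearMap.snd ℝ ℝ E))

@[simp]
theorem chartCylinder_apply (ε : ℝ) (G : E → E →L[ℝ] E →L[ℝ] ℝ) (q u v : ℝ × E) :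
    chartCylinder ε G q u v = ε * (u.1 * v.1) + G q.2 u.2 v.2 := by
  simp [chartCylinder]

theorem contDiffAt_chartCylinder {n : ℕ∞ω} (ε : ℝ) {G : E → E →L[ℝ] E →L[ℝ] ℝ} {p : ℝ × E}
    (hG : ContDiffAt ℝ n G p.2) : ContDiffAt ℝ n (chartCylinder ε G) p := by
  unfold chartCylinder
  exact contDiffAt_const.add
    (contDiffAt_const.clm_comp ((hG.comp p contDiffAt_snd).clm_comp contDiffAt_const))

theorem isInvertible_of_nondegenerate [FiniteDimensional ℝ E] {B : E →L[ℝ] E →L[ℝ] ℝ}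
    (h : ∀ u, (∀ v, B u v = 0) → u = 0) : B.IsInvertible := by
  have hfin : Module.finrank ℝ E = Module.finrank ℝ (E →L[ℝ] ℝ) := by
    rw [← (LinearMap.toContinuousLinearMap : (E →ₗ[ℝ] ℝ) ≃ₗ[ℝ] _).finrank_eq]
    exact (Subspace.dual_finrank_eq (K := ℝ) (V := E)).symm
  have hinj : Function.Injective (B : E →ₗ[ℝ] (E →L[ℝ] ℝ)) := by
    rw [injective_iff_map_eq_zero]
    exact fun u hu => h u fun v => congr($hu v)
  exact ⟨(LinearMap.linearEquivOfInjective _ hinj hfin).toContinuousLinearEquiv, by ext; rfl⟩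

theorem isInvertible_chartCylinder [FiniteDimensional ℝ E] {ε : ℝ} (hε : ε ≠ 0)
    {G : E → E →L[ℝ] E →L[ℝ] ℝ} {p : ℝ × E} (h : (G p.2).IsInvertible) :
    (chartCylinder ε G p).IsInvertible := by
  refine isInvertible_of_nondegenerate fun u hu => Prod.ext ?_ ?_
  · simpa [hε] using hu (1, 0)
  · apply h.injective
    ext v
    simpa using hu (0, v)

theorem christoffel₁_chartCylinder {ε : ℝ} {G : E → E →L[ℝ] E →L[ℝ] ℝ} {p : ℝ × E}
    (hG : DifferentiableAt ℝ G p.2) (u v w : ℝ × E) :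
    christoffel₁ (chartCylinder ε G) p u v w = christoffel₁ G p.2 u.2 v.2 w.2 := by
  have h1 : ∀ u v w : ℝ × E, fderiv ℝ (chartCylinder ε G) p u v w = fderiv ℝ G p.2 u.2 v.2 w.2 := by
    intro u v w
    have h2 : HasFDerivAt (fun q : ℝ × E => G q.2) _ p :=
      hG.hasFDerivAt.comp p hasFDerivAt_snd
    have h3 : HasFDerivAt (chartCylinder ε G) _ p :=
      ((hasFDerivAt_const ((ContinuousLinearMap.snd ℝ ℝ E).precomp ℝ) p).clm_comp
        (h2.clm_comp (hasFDerivAt_const (ContinuousLinearMap.snd ℝ ℝ E) p))).const_add _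
    rw [h3.fderiv]
    simp
  simp only [christoffel₁_apply, h1]

variable [FiniteDimensional ℝ E]

theorem christoffel_chartCylinder {ε : ℝ} (hε : ε ≠ 0) {G : E → E →L[ℝ] E →L[ℝ] ℝ} {p : ℝ × E}
    (h : (G p.2).IsInvertible) (hG : DifferentiableAt ℝ G p.2) (u v : ℝ × E) :
    christoffel (chartCylinder ε G) p u v = (0, christoffel G p.2 u.2 v.2) :=
  christoffel_eq_of (isInvertible_chartCylinder hε h) fun w => by
    simp [christoffel₁_chartCylinder hG, apply_christoffel h]

theorem curvature_chartCylinder {ε : ℝ} (hε : ε ≠ 0) {G : E → E →L[ℝ] E →L[ℝ] ℝ} {p : ℝ × E}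
    (h : (G p.2).IsInvertible) (hG : ContDiffAt ℝ 2 G p.2) (u v w : ℝ × E) :
    curvature (chartCylinder ε G) p u v w = (0, curvature G p.2 u.2 v.2 w.2) := by
  have hd := hG.differentiableAt (by norm_num)
  have hd2 := differentiableAt_christoffel h hG
  have hev : ∀ᶠ q : ℝ × E in 𝓝 p, ∀ u v,
      christoffel (chartCylinder ε G) q u v = (0, christoffel G q.2 u.2 v.2) := by
    filter_upwards [continuousAt_snd.eventually (eventually_isInvertible h hG.continuousAt),
      continuousAt_snd.eventually (hG.eventually (by norm_num))] with q h1 h2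
    exact christoffel_chartCylinder hε h1 (h2.differentiableAt (by norm_num))
  have hD : ∀ u v w : ℝ × E, fderiv ℝ (christoffel (chartCylinder ε G)) p u v w =
      (0, fderiv ℝ (christoffel G) p.2 u.2 v.2 w.2) := fun u v w => by
    have h1 := (((differentiableAt_christoffel (isInvertible_chartCylinder hε h)
      (contDiffAt_chartCylinder ε hG)).hasFDerivAt.clm_apply (hasFDerivAt_const v p)).clm_apply
      (hasFDerivAt_const w p))
    have h2 : HasFDerivAt (fun q : ℝ × E => christoffel G q.2) _ p :=
      hd2.hasFDerivAt.comp p hasFDerivAt_snd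
    have h3 := (hasFDerivAt_const (0 : ℝ) p).prodMk
      ((h2.clm_apply (hasFDerivAt_const v.2 p)).clm_apply (hasFDerivAt_const w.2 p))
    have := congr($(h1.unique (h3.congr_of_eventuallyEq (hev.mono fun q hq => hq v w))) u)
    simpa using this
  simp [curvature, hD, hev.self_of_nhds]

theorem chartRicci_chartCylinder {ε : ℝ} (hε : ε ≠ 0) {G : E → E →L[ℝ] E →L[ℝ] ℝ} {p : ℝ × E}
    (h : (G p.2).IsInvertible) (hG : ContDiffAt ℝ 2 G p.2) (u v : ℝ × E) :
    chartRicci (chartCylinder ε G) p u v = chartRicci G p.2 u.2 v.2 := by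
  unfold chartRicci
  set R : E →ₗ[ℝ] E :=
    { toFun := fun z => curvature G p.2 z u.2 v.2
      map_add' := fun z z' => by simp [curvature]; abel
      map_smul' := fun c z => by simp [curvature, smul_sub, smul_add] } with hR
  have : R = (LinearMap.snd ℝ ℝ E) ∘ₗ (LinearMap.inr ℝ ℝ E ∘ₗ R) := by
    ext; simp
  rw [this, LinearMap.trace_comp_comm']
  congr 1
  refine LinearMap.ext fun z => ?_
  simp [hR, curvature_chartCylinder hε h hG]

omit [FiniteDimensional ℝ E] in
/-- The second derivative of the restriction of a function to an affine subspace. -/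
theorem fderiv_fderiv_comp {V : Type*} [NormedAddCommGroup V] [NormedSpace ℝ V] {F : V → ℝ}
    {i : E → V} {L : E →L[ℝ] V} (hi : ∀ x, HasFDerivAt i L x) {x : E} (hF : ContDiffAt ℝ 2 F (i x))
    (u v : E) :
    fderiv ℝ (fderiv ℝ (F ∘ i)) x u v = fderiv ℝ (fderiv ℝ F) (i x) (L u) (L v) := by
  have h1 : fderiv ℝ (F ∘ i) =ᶠ[𝓝 x] fun y => (fderiv ℝ F (i y)).comp L := by
    filter_upwards [(hi x).continuousAt.eventually (hF.eventually (by norm_num))] with y hy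
    exact ((hy.differentiableAt (by norm_num)).hasFDerivAt.comp y (hi y)).fderiv
  have h2 : HasFDerivAt (fun y => fderiv ℝ F (i y)) _ x :=
    ((hF.fderiv_right (m := 1) (by norm_num)).differentiableAt (by norm_num)).hasFDerivAt.comp
      x (hi x)
  rw [h1.fderiv_eq, (h2.clm_comp (hasFDerivAt_const L x)).fderiv]
  simp

theorem chartHessian_chartCylinder {ε : ℝ} (hε : ε ≠ 0) {G : E → E →L[ℝ] E →L[ℝ] ℝ}
    {F : ℝ × E → ℝ} {p : ℝ × E} (h : (G p.2).IsInvertible) (hG : DifferentiableAt ℝ G p.2)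
    (u v : ℝ × E) :
    chartHessian (chartCylinder ε G) F p u v =
      fderiv ℝ (fderiv ℝ F) p u v - fderiv ℝ F p (0, christoffel G p.2 u.2 v.2) := by
  simp [chartHessian, christoffel_chartCylinder hε h hG]

omit [FiniteDimensional ℝ E] in
theorem chartHessian_slice {G : E → E →L[ℝ] E →L[ℝ] ℝ}
    {F : ℝ × E → ℝ} {p : ℝ × E} (hF : ContDiffAt ℝ 2 F p) (u v : E) :
    chartHessian G (fun y => F (p.1, y)) p.2 u v =
      fderiv ℝ (fderiv ℝ F) p (0, u) (0, v) - fderiv ℝ F p (0, christoffel G p.2 u v) := by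
  have hi : ∀ x : E, HasFDerivAt (fun y : E => (p.1, y)) (ContinuousLinearMap.inr ℝ ℝ E) x :=
    fun x => hasFDerivAt_prodMk_right p.1 x
  have h1 := fderiv_fderiv_comp hi (x := p.2) (F := F) hF u v
  have h2 := ((hF.differentiableAt (by norm_num)).hasFDerivAt.comp p.2 (hi p.2)).fderiv
  change fderiv ℝ (fderiv ℝ (F ∘ fun y => (p.1, y))) p.2 u v -
    fderiv ℝ (F ∘ fun y => (p.1, y)) p.2 _ = _
  rw [h1, h2]
  simp

/-- The Einstein equation for `F⁻² (ε dt² + G)` in a chart. -/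
theorem einstein_equations {ε : ℝ} (hε : ε = 1 ∨ ε = -1) (hm : 2 ≤ Module.finrank ℝ E)
    {G : E → E →L[ℝ] E →L[ℝ] ℝ} {F : ℝ × E → ℝ} {p : ℝ × E}
    (h : (G p.2).IsInvertible) (hG : ContDiffAt ℝ 2 G p.2) (hF : ContDiffAt ℝ 2 F p)
    (hF0 : F p ≠ 0) (hs : ∀ᶠ q in 𝓝 p.2, ∀ v w, G q v w = G q w v) {l : ℝ}
    (hE : ∀ u v, chartRicci (fun q => (F q ^ 2)⁻¹ • chartCylinder ε G q) p u v =
      l * chartCylinder ε G p u v) :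
    (∀ v, fderiv ℝ (fderiv ℝ F) p (1, 0) (0, v) = 0) ∧
    ∀ u v, ((Module.finrank ℝ E : ℝ) - 1) * chartHessian G (fun y => F (p.1, y)) p.2 u v
      + F p * chartRicci G p.2 u v =
        ((Module.finrank ℝ E : ℝ) - 1) * (ε * fderiv ℝ (fderiv ℝ F) p (1, 0) (1, 0)) *
          G p.2 u v := by
  have hε0 : ε ≠ 0 := by rcases hε with rfl | rfl <;> norm_num
  have hε2 : ε * ε = 1 := by rcases hε with rfl | rfl <;> norm_num
  have hm' : (2 : ℝ) ≤ Module.finrank ℝ E := by exact_mod_cast hm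
  have hd := hG.differentiableAt (by norm_num)
  obtain ⟨φ, hφ⟩ := chartRicci_conformal (isInvertible_chartCylinder hε0 h)
    (contDiffAt_chartCylinder ε hG) hF hF0
    ((continuousAt_snd.eventually hs).mono fun q hq v w => by
      rw [chartCylinder_apply, chartCylinder_apply, hq, mul_comm v.1])
  have key : ∀ u v : ℝ × E, F p * chartRicci G p.2 u.2 v.2 + ((Module.finrank ℝ E : ℝ) - 1) *
      (fderiv ℝ (fderiv ℝ F) p u v - fderiv ℝ F p (0, christoffel G p.2 u.2 v.2)) =
      F p * (l - φ) * (ε * (u.1 * v.1) + G p.2 u.2 v.2) := fun u v => by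
    have h1 := hφ u v
    rw [hE, chartRicci_chartCylinder hε0 h hG, chartHessian_chartCylinder hε0 h hd,
      chartCylinder_apply, Module.finrank_prod, Module.finrank_self] at h1
    push_cast at h1
    have h2 := congr(F p * $h1)
    field_simp at h2
    linarith
  have hR : ∀ v, chartRicci G p.2 0 v = 0 := fun v => by
    have : ∀ z, curvature G p.2 z 0 v = 0 := fun z => by simp [curvature]
    simp only [chartRicci, this]
    exact map_zero (LinearMap.trace ℝ E)
  refine ⟨fun v => ?_, fun u v => ?_⟩
  · have h1 := key (1, 0) (0, v)
    simp only [hR, map_zero, zero_apply, Prod.mk_zero_zero] at h1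
    have : ((Module.finrank ℝ E : ℝ) - 1) * fderiv ℝ (fderiv ℝ F) p (1, 0) (0, v) = 0 := by
      linarith
    exact (mul_eq_zero.1 this).resolve_left (by linarith)
  · have h1 := key (1, 0) (1, 0)
    simp only [hR, map_zero, Prod.mk_zero_zero] at h1
    have h2 := key (0, u) (0, v)
    rw [chartHessian_slice hF]
    have h3 : ((Module.finrank ℝ E : ℝ) - 1) *
        (ε * fderiv ℝ (fderiv ℝ F) p (1, 0) (1, 0)) = F p * (l - φ) := by
      linear_combination ε * h1 + F p * (l - φ) * hε2
    rw [h3]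
    simp only [mul_zero, zero_add] at h2
    linarith

end Cylinder

section ChartRep

variable {E : Type*} [NormedAddCommGroup E] [NormedSpace ℝ E]
  {H : Type*} [TopologicalSpace H] {I : ModelWithCorners ℝ E H}
  {M : Type*} [TopologicalSpace M] [ChartedSpace H M]

theorem chartRep_eq_of_eq (g : TwoTensor I M) {x₀ : M} {s : E → M}
    (hs : (extChartAt I x₀).symm = s) (y u v : E) :
    chartRep g x₀ y u v = g (s y) (mfderiv 𝓘(ℝ, E) I s y u) (mfderiv 𝓘(ℝ, E) I s y v) := by
  subst hs; rfl

theorem chartRep_symm {g : TwoTensor I M} (hg : ∀ (x : M) (u v : TangentSpace I x),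
    g x u v = g x v u) (x₀ : M) (y u v : E) :
    chartRep g x₀ y u v = chartRep g x₀ y v u := by
  rw [chartRep_eq_of_eq g rfl, chartRep_eq_of_eq g rfl, hg]

theorem cylinderMetric_apply (ε : ℝ) (g : TwoTensor I M) (p : ℝ × M)
    (u v : TangentSpace (𝓘(ℝ, ℝ).prod I) p) :
    cylinderMetric ε g p u v = ε * (u.1 * v.1) + g p.2 u.2 v.2 := by
  simp only [cylinderMetric, pullback, dtSq, mfderiv_fst, mfderiv_snd]
  rfl

variable [I.Boundaryless]

theorem hasMFDerivAt_extChartAt_symm_self (x : M) :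
    HasMFDerivAt 𝓘(ℝ, E) I (extChartAt I x).symm (extChartAt I x x)
      (ContinuousLinearMap.id ℝ E) := by
  refine ⟨continuousAt_extChartAt_symm x, ?_⟩
  have h1 : writtenInExtChartAt 𝓘(ℝ, E) I (extChartAt I x x) (extChartAt I x).symm
      =ᶠ[𝓝 (extChartAt I x x)] id := by
    filter_upwards [extChartAt_target_mem_nhds (I := I) x] with y hy
    simp only [writtenInExtChartAt, extChartAt_to_inv, extChartAt_model_space_eq_id,
      PartialEquiv.refl_symm, PartialEquiv.refl_coe, Function.comp_apply, id_eq]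
    exact (extChartAt I x).right_inv hy
  exact ((hasFDerivAt_id _).congr_of_eventuallyEq h1).hasFDerivWithinAt

theorem chartRep_self (g : TwoTensor I M) (x : M) (u v : E) :
    chartRep g x (extChartAt I x x) u v = g x u v := by
  have h : ∀ x', x' = x → ∀ u v : E, g x' u v = g x u v := by rintro _ rfl _ _; rfl
  rw [chartRep_eq_of_eq g rfl, (hasMFDerivAt_extChartAt_symm_self (I := I) x).mfderiv]
  exact h _ (extChartAt_to_inv x) u v

theorem isInvertible_chartRep_self [FiniteDimensional ℝ E] {g : TwoTensor I M} {x : M}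
    (hg : ∀ u : TangentSpace I x, (∀ v, g x u v = 0) → u = 0) :
    (chartRep g x (extChartAt I x x)).IsInvertible :=
  isInvertible_of_nondegenerate fun u hu => hg u fun v => (chartRep_self g x u v).symm.trans (hu v)

theorem chartRep_conformal_cylinder [IsManifold I 1 M] (ε : ℝ) (g : TwoTensor I M)
    (f : ℝ × M → ℝ) (t : ℝ) (x : M) {q : ℝ × E} (hq : q.2 ∈ (extChartAt I x).target) :
    chartRep (conformalChange f (cylinderMetric ε g)) (t, x) q =
      (f (q.1, (extChartAt I x).symm q.2) ^ 2)⁻¹ • chartCylinder ε (chartRep g x) q := by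
  have hs : ((extChartAt (𝓘(ℝ, ℝ).prod I) (t, x)).symm : ℝ × E → ℝ × M) =
      fun q => (q.1, (extChartAt I x).symm q.2) := by
    funext q
    rw [extChartAt_prod, extChartAt_model_space_eq_id]
    rfl
  have hA : MDifferentiableAt 𝓘(ℝ, E) I (extChartAt I x).symm q.2 :=
    ((contMDiffOn_extChartAt_symm (n := 1) x).contMDiffAt
      ((isOpen_extChartAt_target x).mem_nhds hq)).mdifferentiableAt (by norm_num)
  have hd : HasMFDerivAt 𝓘(ℝ, ℝ × E) (𝓘(ℝ, ℝ).prod I)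
      (fun q : ℝ × E => (q.1, (extChartAt I x).symm q.2)) q
      ((ContinuousLinearMap.fst ℝ ℝ E).prod
        ((mfderiv 𝓘(ℝ, E) I (extChartAt I x).symm q.2).comp (ContinuousLinearMap.snd ℝ ℝ E))) :=
    (hasFDerivAt_fst.hasMFDerivAt).prodMk
      (hA.hasMFDerivAt.comp q (hasFDerivAt_snd (𝕜 := ℝ) (p := q)).hasMFDerivAt)
  refine ContinuousLinearMap.ext fun u => ContinuousLinearMap.ext fun v => ?_
  rw [chartRep_eq_of_eq _ hs, hd.mfderiv]
  simp only [smul_apply, chartCylinder_apply]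
  rw [chartRep_eq_of_eq g rfl]
  change (f (q.1, (extChartAt I x).symm q.2) ^ 2)⁻¹ * (cylinderMetric ε g _ _ _) = _
  rw [cylinderMetric_apply]
  rfl

end ChartRep

section EinsteinCylinder

variable {E : Type*} [NormedAddCommGroup E] [NormedSpace ℝ E] [FiniteDimensional ℝ E]
  {H : Type*} [TopologicalSpace H] {I : ModelWithCorners ℝ E H} [I.Boundaryless]
  {M : Type*} [TopologicalSpace M] [ChartedSpace H M] [IsManifold I 4 M]

omit [FiniteDimensional ℝ E] in
theorem contDiffAt_slab {J : Set ℝ} (hJ : IsOpen J) {f : ℝ × M → ℝ}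
    (hf : ContMDiffOn (𝓘(ℝ, ℝ).prod I) 𝓘(ℝ, ℝ) 4 f (J ×ˢ Set.univ)) (x : M) {q : ℝ × E}
    (hq1 : q.1 ∈ J) (hq2 : q.2 ∈ (extChartAt I x).target) :
    ContDiffAt ℝ 4 (fun q : ℝ × E => f (q.1, (extChartAt I x).symm q.2)) q := by
  have h1 : ContMDiffAt 𝓘(ℝ, E) I 4 (extChartAt I x).symm q.2 :=
    (contMDiffOn_extChartAt_symm x).contMDiffAt ((isOpen_extChartAt_target x).mem_nhds hq2)
  have h2 : ContMDiffAt 𝓘(ℝ, ℝ × E) (𝓘(ℝ, ℝ).prod I) 4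
      (fun q : ℝ × E => (q.1, (extChartAt I x).symm q.2)) q :=
    contDiffAt_fst.contMDiffAt.prodMk (h1.comp q contDiffAt_snd.contMDiffAt)
  have h3 : ContMDiffAt (𝓘(ℝ, ℝ).prod I) 𝓘(ℝ, ℝ) 4 f (q.1, (extChartAt I x).symm q.2) :=
    hf.contMDiffAt ((hJ.prod isOpen_univ).mem_nhds ⟨hq1, trivial⟩)
  exact contMDiffAt_iff_contDiffAt.1 (h3.comp q h2)

theorem deriv_deriv_eq {h : ℝ → ℝ} {t : ℝ} (hh : ContDiffAt ℝ 2 h t) :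
    deriv (deriv h) t = fderiv ℝ (fderiv ℝ h) t 1 1 := by
  have h1 : DifferentiableAt ℝ (fderiv ℝ h) t :=
    (hh.fderiv_right (m := 1) (by norm_num)).differentiableAt (by norm_num)
  have h2 := (h1.hasFDerivAt.clm_apply (hasFDerivAt_const (1 : ℝ) t)).fderiv
  change fderiv ℝ (fun s => fderiv ℝ h s 1) t 1 = _
  rw [h2]
  simp

/-- The Einstein equation for `f⁻² (ε dt² + g)` at a point where `f ≠ 0`. -/
theorem einstein_equations_manifold (hm : 2 ≤ Module.finrank ℝ E) {g : TwoTensor I M}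
    (hg : IsPseudoRiemannianMetric 3 g) {ε : ℝ} (hε : ε = 1 ∨ ε = -1)
    {J : Set ℝ} (hJ : IsOpen J) {f : ℝ × M → ℝ}
    (hf : ContMDiffOn (𝓘(ℝ, ℝ).prod I) 𝓘(ℝ, ℝ) 4 f (J ×ˢ Set.univ))
    (hE : IsEinsteinOn (conformalChange f (cylinderMetric ε g)) {p : ℝ × M | p.1 ∈ J ∧ f p ≠ 0})
    {t : ℝ} (ht : t ∈ J) {x : M} (hf0 : f (t, x) ≠ 0) :
    (∀ v, fderiv ℝ (fderiv ℝ (fun q : ℝ × E => f (q.1, (extChartAt I x).symm q.2)))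
      (t, extChartAt I x x) (1, 0) (0, v) = 0) ∧
    ∀ u v : TangentSpace I x, ((Module.finrank ℝ E : ℝ) - 1) * hessian g (fun y => f (t, y)) x u v
      + f (t, x) * ricci g x u v =
        ((Module.finrank ℝ E : ℝ) - 1) * (ε * deriv (deriv fun s => f (s, x)) t) * g x u v := by
  have : IsManifold I 1 M := IsManifold.of_le (n := 4) (by norm_num)
  obtain ⟨lam, hlam, -⟩ := hE
  have htar := mem_extChartAt_target (I := I) x
  have hnhds := extChartAt_target_mem_nhds (I := I) x
  set F : ℝ × E → ℝ := fun q => f (q.1, (extChartAt I x).symm q.2) with hF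
  set p : ℝ × E := (t, extChartAt I x x) with hp
  have hFp : F p = f (t, x) := by simp [hF, hp]
  have hFc : ContDiffAt ℝ 2 F p :=
    (contDiffAt_slab hJ hf x (q := p) ht htar).of_le (by norm_num)
  have hG : ContDiffAt ℝ 2 (chartRep g x) p.2 :=
    ((hg.contDiffOn x).contDiffAt hnhds).of_le (by norm_num)
  have hinv : (chartRep g x p.2).IsInvertible :=
    isInvertible_chartRep_self (hg.nondegenerate x)
  have hev : chartRep (conformalChange f (cylinderMetric ε g)) (t, x) =ᶠ[𝓝 p]
      fun q => (F q ^ 2)⁻¹ • chartCylinder ε (chartRep g x) q := by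
    filter_upwards [(continuousAt_snd (p := p)).preimage_mem_nhds hnhds] with q hq
    exact chartRep_conformal_cylinder ε g f t x hq
  have hpt : extChartAt (𝓘(ℝ, ℝ).prod I) (t, x) (t, x) = p := by
    rw [extChartAt_prod, extChartAt_model_space_eq_id]
    rfl
  have key := einstein_equations hε hm hinv hG hFc (hFp ▸ hf0)
    (.of_forall fun q => chartRep_symm hg.symm x q) (l := lam (t, x) * (f (t, x) ^ 2)⁻¹)
    fun u v => by
      rw [← chartRicci_congr hev, chartCylinder_apply, mul_assoc]
      have h1 := hlam (t, x) ⟨ht, hf0⟩ u v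
      unfold ricci at h1
      rw [hpt] at h1
      refine h1.trans ?_
      exact congrArg (fun r => lam (t, x) * ((f (t, x) ^ 2)⁻¹ * r))
        ((cylinderMetric_apply ε g (t, x) u v).trans
          (congrArg (fun r => ε * (u.1 * v.1) + r) (chartRep_self g x u.2 v.2).symm))
  refine ⟨key.1, fun u v => ?_⟩
  have hi : ∀ s : ℝ, HasFDerivAt (fun s : ℝ => (s, extChartAt I x x))
      (ContinuousLinearMap.inl ℝ ℝ E) s := fun s => hasFDerivAt_prodMk_left s _
  have h2 : (fun s => f (s, x)) = F ∘ fun s : ℝ => (s, extChartAt I x x) := by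
    funext s; simp [hF]
  have h3 : deriv (deriv fun s => f (s, x)) t = fderiv ℝ (fderiv ℝ F) p (1, 0) (1, 0) := by
    rw [h2, deriv_deriv_eq, fderiv_fderiv_comp hi hFc]
    · simp [hp]
    · exact hFc.comp t (contDiffAt_id.prodMk contDiffAt_const)
  have h4 := key.2 u v
  rw [h3, ← chartRep_self g x u v, ← hFp]
  exact h4

/-- The derivative in the direction of `t` of a solution does not depend on `x`, locally. -/
theorem fderiv_deriv_eq_zero (hm : 2 ≤ Module.finrank ℝ E) {g : TwoTensor I M}
    (hg : IsPseudoRiemannianMetric 3 g) {ε : ℝ} (hε : ε = 1 ∨ ε = -1)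
    {J : Set ℝ} (hJ : IsOpen J) {f : ℝ × M → ℝ}
    (hf : ContMDiffOn (𝓘(ℝ, ℝ).prod I) 𝓘(ℝ, ℝ) 4 f (J ×ˢ Set.univ))
    (hE : IsEinsteinOn (conformalChange f (cylinderMetric ε g)) {p : ℝ × M | p.1 ∈ J ∧ f p ≠ 0})
    {t : ℝ} (ht : t ∈ J) (x₀ : M) {y : E} (hy : y ∈ (extChartAt I x₀).target) :
    HasFDerivAt (fun y => deriv (fun s => f (s, (extChartAt I x₀).symm y)) t) (0 : E →L[ℝ] ℝ) y := by
  have : IsManifold I 1 M := IsManifold.of_le (n := 4) (by norm_num)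
  set F : M → ℝ × E → ℝ := fun x q => f (q.1, (extChartAt I x).symm q.2) with hF
  have hFc : ∀ x t y, t ∈ J → y ∈ (extChartAt I x).target → ContDiffAt ℝ 4 (F x) (t, y) :=
    fun x t y ht hy => contDiffAt_slab hJ hf x (q := (t, y)) ht hy
  have hd : ∀ x t y, t ∈ J → y ∈ (extChartAt I x).target →
      deriv (fun s => f (s, (extChartAt I x).symm y)) t = fderiv ℝ (F x) (t, y) (1, 0) := by
    intro x t y ht hy
    have h1 := ((hFc x t y ht hy).differentiableAt (by norm_num)).hasFDerivAt.comp_hasDerivAt t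
      ((hasDerivAt_id t).prodMk (hasDerivAt_const t y))
    exact h1.deriv
  have hder : ∀ x t y, t ∈ J → y ∈ (extChartAt I x).target →
      HasFDerivAt (fun y => deriv (fun s => f (s, (extChartAt I x).symm y)) t)
        ((fderiv ℝ (fderiv ℝ (F x)) (t, y) (1, 0)).comp (ContinuousLinearMap.inr ℝ ℝ E)) y := by
    intro x t y ht hy
    have h1 : (fun y => deriv (fun s => f (s, (extChartAt I x).symm y)) t) =ᶠ[𝓝 y]
        fun y => fderiv ℝ (F x) (t, y) (1, 0) := by
      filter_upwards [(isOpen_extChartAt_target x).mem_nhds hy] with z hz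
      exact hd x t z ht hz
    have h2 : DifferentiableAt ℝ (fderiv ℝ (F x)) (t, y) :=
      ((hFc x t y ht hy).fderiv_right (m := 3) (by norm_num)).differentiableAt (by norm_num)
    have h3 : HasFDerivAt (fun y => fderiv ℝ (F x) (t, y)) _ y :=
      h2.hasFDerivAt.comp y (hasFDerivAt_prodMk_right t y)
    refine ((h3.clm_apply (hasFDerivAt_const ((1 : ℝ), (0 : E)) y)).congr_of_eventuallyEq
      h1).congr_fderiv ?_
    ext v
    have := (hFc x t y ht hy).isSymmSndFDerivAt (by simp; norm_num) (0, v) (1, 0)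
    simpa using this
  have hne : ∀ x t y, t ∈ J → y ∈ (extChartAt I x).target → F x (t, y) ≠ 0 →
      HasFDerivAt (fun y => deriv (fun s => f (s, (extChartAt I x).symm y)) t)
        (0 : E →L[ℝ] ℝ) y := by
    intro x t y ht hy h0
    set x' := (extChartAt I x).symm y with hx'
    have h1 := (einstein_equations_manifold hm hg hε hJ hf hE ht (x := x') h0).1
    have h2 : HasFDerivAt (fun y => deriv (fun s => f (s, (extChartAt I x').symm y)) t)
        (0 : E →L[ℝ] ℝ) (extChartAt I x' x') :=
      (hder x' t _ ht (mem_extChartAt_target x')).congr_fderiv (by ext v; exact h1 v)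
    have h3 : MDifferentiableAt 𝓘(ℝ, E) I (extChartAt I x).symm y :=
      ((contMDiffOn_extChartAt_symm (n := 1) x).contMDiffAt
        ((isOpen_extChartAt_target x).mem_nhds hy)).mdifferentiableAt (by norm_num)
    have h4 : MDifferentiableAt I 𝓘(ℝ, E) (extChartAt I x') x' :=
      (contMDiffAt_extChartAt (n := 1)).mdifferentiableAt (by norm_num)
    have h5 : DifferentiableAt ℝ (extChartAt I x' ∘ (extChartAt I x).symm) y :=
      mdifferentiableAt_iff_differentiableAt.1 (h4.comp y h3)
    have h6 := (h2.comp y h5.hasFDerivAt).congr_fderiv (ContinuousLinearMap.zero_comp _)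
    refine h6.congr_of_eventuallyEq ?_
    filter_upwards [h3.continuousAt.eventually (extChartAt_source_mem_nhds (I := I) x')] with z hz
    simp only [Function.comp_apply, (extChartAt I x').left_inv hz]
  suffices h : (fderiv ℝ (fderiv ℝ (F x₀)) (t, y) (1, 0)).comp (ContinuousLinearMap.inr ℝ ℝ E) = 0
    from h ▸ hder x₀ t y ht hy
  ext v
  by_contra hcon
  have hc : ContinuousAt (fun q => fderiv ℝ (fderiv ℝ (F x₀)) q (1, 0) (0, v)) (t, y) :=
    ((((hFc x₀ t y ht hy).fderiv_right (m := 3) (by norm_num)).fderiv_right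
      (m := 2) (by norm_num)).continuousAt.clm_apply continuousAt_const).clm_apply
        continuousAt_const
  have h0 : F x₀ =ᶠ[𝓝 (t, y)] fun _ => 0 := by
    filter_upwards [hc.eventually_ne (by simpa using hcon),
      (hJ.prod (isOpen_extChartAt_target (I := I) x₀)).mem_nhds (⟨ht, hy⟩ : (t, y) ∈ J ×ˢ _)]
      with q hq1 hq2
    by_contra hq3
    have := (hne x₀ q.1 q.2 hq2.1 hq2.2 hq3).unique (hder x₀ q.1 q.2 hq2.1 hq2.2)
    exact hq1 (by simpa using congr($this v).symm)
  apply hcon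
  rw [h0.fderiv.fderiv_eq]
  simp

/-- A solution is the sum of a function of `t` and a function of `x`. -/
theorem sub_eq_sub_of_einstein [PreconnectedSpace M] (hm : 2 ≤ Module.finrank ℝ E)
    {g : TwoTensor I M} (hg : IsPseudoRiemannianMetric 3 g) {ε : ℝ} (hε : ε = 1 ∨ ε = -1)
    {J : Set ℝ} (hJ : IsOpen J) (hJc : J.OrdConnected) {f : ℝ × M → ℝ}
    (hf : ContMDiffOn (𝓘(ℝ, ℝ).prod I) 𝓘(ℝ, ℝ) 4 f (J ×ˢ Set.univ))
    (hE : IsEinsteinOn (conformalChange f (cylinderMetric ε g)) {p : ℝ × M | p.1 ∈ J ∧ f p ≠ 0})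
    {t s : ℝ} (ht : t ∈ J) (hs : s ∈ J) (x y : M) :
    f (t, x) - f (t, y) = f (s, x) - f (s, y) := by
  have hloc : ∀ t ∈ J, IsLocallyConstant fun x => deriv (fun s => f (s, x)) t := by
    intro t ht
    rw [IsLocallyConstant.iff_eventually_eq]
    intro x
    obtain ⟨r, hr, hball⟩ := Metric.isOpen_iff.1 (isOpen_extChartAt_target (I := I) x) _
      (mem_extChartAt_target x)
    filter_upwards [(continuousAt_extChartAt (I := I) x).eventually (Metric.ball_mem_nhds _ hr),
      extChartAt_source_mem_nhds (I := I) x] with z hz hzs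
    have hk := fun y (hy : y ∈ Metric.ball (extChartAt I x x) r) =>
      fderiv_deriv_eq_zero hm hg hε hJ hf hE ht x (hball hy)
    have := Metric.isOpen_ball.is_const_of_fderiv_eq_zero
      (convex_ball (extChartAt I x x) r).isPreconnected
      (fun y hy => (hk y hy).differentiableAt.differentiableWithinAt)
      (fun y hy => (hk y hy).fderiv) hz (Metric.mem_ball_self hr)
    simpa only [(extChartAt I x).left_inv hzs, extChartAt_to_inv] using this
  have hdiff : ∀ x, ∀ t ∈ J, DifferentiableAt ℝ (fun s => f (s, x)) t := fun x t ht => by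
    have h1 := (contDiffAt_slab hJ hf x (q := (t, extChartAt I x x)) ht
      (mem_extChartAt_target x)).comp t (contDiffAt_id.prodMk contDiffAt_const)
    simpa [Function.comp_def] using h1.differentiableAt (by norm_num)
  refine hJ.is_const_of_deriv_eq_zero (f := fun t => f (t, x) - f (t, y)) hJc.isPreconnected
    (fun t ht => ((hdiff x t ht).sub (hdiff y t ht)).differentiableWithinAt) (fun t ht => ?_) ht hs
  have h1 : deriv (fun t => f (t, x) - f (t, y)) t = _ :=
    deriv_sub (hdiff x t ht) (hdiff y t ht)
  rw [h1, (hloc t ht).apply_eq_of_preconnectedSpace x y]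
  simp

omit [I.Boundaryless] [IsManifold I 4 M] [FiniteDimensional ℝ E] in
theorem hessian_const_add (g : TwoTensor I M) (b : M → ℝ) (c : ℝ) (x : M)
    (u v : TangentSpace I x) : hessian g (fun y => c + b y) x u v = hessian g b x u v := by
  have : fderiv ℝ ((fun y => c + b y) ∘ (extChartAt I x).symm) =
      fderiv ℝ (b ∘ (extChartAt I x).symm) := by
    funext y
    exact fderiv_const_add (f := b ∘ (extChartAt I x).symm) c
  simp only [hessian, chartHessian, this]

omit [IsManifold I 4 M] in
/-- A Hessian that is a multiple of the metric is its trace-part. -/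
theorem laplacian_of_hessian_eq {g : TwoTensor I M} {x : M}
    (hg : ∀ u : TangentSpace I x, (∀ v, g x u v = 0) → u = 0) {b : M → ℝ} {ψ : ℝ}
    (h : ∀ u v, hessian g b x u v = ψ * g x u v) :
    laplacian g b x = ψ * Module.finrank ℝ E := by
  have hinv : (chartRep g x (extChartAt I x x)).IsInvertible :=
    isInvertible_chartRep_self hg
  have h1 : chartHessian (chartRep g x) (b ∘ (extChartAt I x).symm) (extChartAt I x x) =
      ψ • chartRep g x (extChartAt I x x) := by
    refine ContinuousLinearMap.ext fun u => ContinuousLinearMap.ext fun v => ?_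
    refine (h u v).trans ?_
    rw [← chartRep_self]
    rfl
  rw [laplacian, chartLaplacian, h1, ContinuousLinearMap.comp_smul, hinv.inverse_comp_self]
  simp

end EinsteinCylinder

end PseudoRiem

end

/-- A continuous non-constant function on an interval takes two values outside a finite set. -/
theorem exists_two_values {J : Set ℝ} (hJ : J.OrdConnected) {a : ℝ → ℝ} (ha : ContinuousOn a J)
    (hne : ¬ ∃ c : ℝ, ∀ t ∈ J, a t = c) {S : Set ℝ} (hS : S.Finite) :
    ∃ t ∈ J, ∃ s ∈ J, a t ≠ a s ∧ a t ∉ S ∧ a s ∉ S := by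
  have h1 : (a '' J).Nontrivial := by
    rw [← Set.not_subsingleton_iff]
    intro h
    rcases J.eq_empty_or_nonempty with rfl | ⟨t, ht⟩
    · exact hne ⟨0, by simp⟩
    · exact hne ⟨a t, fun s hs => h ⟨s, hs, rfl⟩ ⟨t, ht, rfl⟩⟩
  have h2 : (a '' J).Infinite :=
    (hJ.isPreconnected.image a ha).infinite_of_nontrivial h1
  obtain ⟨_, ⟨⟨t, ht, rfl⟩, ht'⟩, _, ⟨⟨s, hs, rfl⟩, hs'⟩, hts⟩ := (h2.sdiff hS).nontrivial
  exact ⟨t, ht, s, hs, hts, ht', hs'⟩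

theorem mainTheorem9 (m : ℕ) (hm : 2 ≤ m)
    (M : Type*) [TopologicalSpace M] [ChartedSpace (EuclideanSpace ℝ (Fin m)) M]
    [IsManifold (𝓡 m) 4 M] [ConnectedSpace M]
    (g : PseudoRiem.TwoTensor (𝓡 m) M) (hg : PseudoRiem.IsPseudoRiemannianMetric 3 g)
    (ε : ℝ) (hε : ε = 1 ∨ ε = -1)
    (J : Set ℝ) (hJo : IsOpen J) (hJc : J.OrdConnected)
    (f : ℝ × M → ℝ)
    (hf : ContMDiffOn (𝓘(ℝ, ℝ).prod (𝓡 m)) 𝓘(ℝ, ℝ) 4 f (J ×ˢ Set.univ))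
    (hfc : ¬ ∃ c : ℝ, ∀ t ∈ J, ∀ x : M, f (t, x) = c)
    (hE : PseudoRiem.IsEinsteinOn
      (PseudoRiem.conformalChange f (PseudoRiem.cylinderMetric ε g))
      {p : ℝ × M | p.1 ∈ J ∧ f p ≠ 0}) :
    (∃ a : ℝ → ℝ, ∀ t ∈ J, ∀ x : M, f (t, x) = a t) ∨
    (∃ b : M → ℝ, ∀ t ∈ J, ∀ x : M, f (t, x) = b x) ∨
    (∃ (a : ℝ → ℝ) (b : M → ℝ),
      ContDiffOn ℝ 4 a J ∧ ContMDiff (𝓡 m) 𝓘(ℝ, ℝ) 4 b ∧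
      (∀ t ∈ J, ∀ x : M, f (t, x) = a t + b x) ∧
      (¬ ∃ c : ℝ, ∀ t ∈ J, a t = c) ∧ (¬ ∃ c : ℝ, ∀ x : M, b x = c) ∧
      ∃ k c : ℝ,
        PseudoRiem.IsEinsteinWith g k ∧
        (∀ t ∈ J, deriv (deriv a) t = ε * k * a t + c) ∧
        (∀ (x : M) (u v : TangentSpace (𝓡 m) x),
          PseudoRiem.hessian g b x u v = PseudoRiem.laplacian g b x / m * g x u v)) := by
  have hfin : Module.finrank ℝ (EuclideanSpace ℝ (Fin m)) = m := by simp
  have hm' : 2 ≤ Module.finrank ℝ (EuclideanSpace ℝ (Fin m)) := hfin.symm ▸ hm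
  have hmR : (2 : ℝ) ≤ m := by exact_mod_cast hm
  have hε2 : ε * ε = 1 := by rcases hε with rfl | rfl <;> norm_num
  rcases J.eq_empty_or_nonempty with rfl | ⟨t₀, ht₀⟩
  · exact absurd ⟨0, by simp⟩ hfc
  obtain ⟨x₀⟩ := (inferInstance : Nonempty M)
  obtain ⟨a, ha⟩ : ∃ a : ℝ → ℝ, a = fun t => f (t, x₀) := ⟨_, rfl⟩
  obtain ⟨b, hb⟩ : ∃ b : M → ℝ, b = fun x => f (t₀, x) - f (t₀, x₀) := ⟨_, rfl⟩
  have hab : ∀ t ∈ J, ∀ x, f (t, x) = a t + b x := fun t ht x => by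
    have := PseudoRiem.sub_eq_sub_of_einstein hm' hg hε hJo hJc hf hE ht ht₀ x x₀
    simp only [ha, hb]
    linarith
  by_cases hac : ∃ c : ℝ, ∀ t ∈ J, a t = c
  · obtain ⟨c, hc⟩ := hac
    exact .inr (.inl ⟨fun x => c + b x, fun t ht x => by rw [hab t ht, hc t ht]⟩)
  by_cases hbc : ∃ c : ℝ, ∀ x : M, b x = c
  · obtain ⟨c, hc⟩ := hbc
    exact .inl ⟨fun t => a t + c, fun t ht x => by rw [hab t ht, hc]⟩
  have haC : ContDiffOn ℝ 4 a J := by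
    rw [← contMDiffOn_iff_contDiffOn, ha]
    exact hf.comp (contMDiff_id.prodMk contMDiff_const).contMDiffOn fun t ht => ⟨ht, trivial⟩
  have hbC : ContMDiff (𝓡 m) 𝓘(ℝ, ℝ) 4 b := by
    rw [hb]
    exact (hf.comp_contMDiff (contMDiff_const.prodMk contMDiff_id) fun x => ⟨ht₀, trivial⟩).sub
      contMDiff_const
  refine .inr (.inr ⟨a, b, haC, hbC, hab, hac, hbc, ?_⟩)
  have eqn : ∀ t ∈ J, ∀ x, a t + b x ≠ 0 → ∀ u v : TangentSpace (𝓡 m) x,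
      ((m : ℝ) - 1) * PseudoRiem.hessian g b x u v + (a t + b x) * PseudoRiem.ricci g x u v =
        ((m : ℝ) - 1) * (ε * deriv (deriv a) t) * g x u v := by
    intro t ht x hne u v
    have h1 := (PseudoRiem.einstein_equations_manifold hm' hg hε hJo hf hE ht (x := x)
      (by rwa [hab t ht])).2 u v
    have h2 : (fun y => f (t, y)) = fun y => a t + b y := funext (hab t ht)
    have h3 : (fun s => f (s, x)) =ᶠ[nhds t] fun s => a s + b x := by
      filter_upwards [hJo.mem_nhds ht] with s hs using hab s hs x
    rw [h2, PseudoRiem.hessian_const_add, h3.deriv.deriv_eq, hab t ht, hfin] at h1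
    simpa using h1
  have hg0 : ∀ x : M, ∃ u v : TangentSpace (𝓡 m) x, g x u v ≠ 0 := by
    intro x
    by_contra! h
    have : Nontrivial (EuclideanSpace ℝ (Fin m)) :=
      Module.nontrivial_of_finrank_pos (R := ℝ) (by omega)
    obtain ⟨u, hu⟩ := exists_ne (0 : EuclideanSpace ℝ (Fin m))
    exact hu (hg.nondegenerate x u (h u))
  have hpt : ∀ x : M, ∃ k c : ℝ,
      (∀ t ∈ J, a t + b x ≠ 0 → deriv (deriv a) t = ε * k * a t + c) ∧
      (∀ u v, PseudoRiem.ricci g x u v = ((m : ℝ) - 1) * k * g x u v) ∧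
      ∃ ψ, ∀ u v, PseudoRiem.hessian g b x u v = ψ * g x u v := by
    intro x
    obtain ⟨t, ht, s, hs, hts, ht', hs'⟩ :=
      exists_two_values hJc haC.continuousOn hac (Set.finite_singleton (-b x))
    have ht0 : a t + b x ≠ 0 := fun h => ht' (by simp; linarith)
    have hs0 : a s + b x ≠ 0 := fun h => hs' (by simp; linarith)
    have hd : a t - a s ≠ 0 := sub_ne_zero.2 hts
    obtain ⟨k, hk⟩ : ∃ k, k * (a t - a s) = ε * (deriv (deriv a) t - deriv (deriv a) s) :=
      ⟨_, div_mul_cancel₀ _ hd⟩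
    have hRic : ∀ u v, PseudoRiem.ricci g x u v = ((m : ℝ) - 1) * k * g x u v := fun u v => by
      apply mul_left_cancel₀ hd
      linear_combination eqn t ht x ht0 u v - eqn s hs x hs0 u v - ((m : ℝ) - 1) * g x u v * hk
    refine ⟨k, deriv (deriv a) t - ε * k * a t, fun r hr hr0 => ?_, hRic,
      ε * deriv (deriv a) t - (a t + b x) * k, fun u v => ?_⟩
    · obtain ⟨u, v, huv⟩ := hg0 x
      have h1 := eqn r hr x hr0 u v
      have h2 := eqn t ht x ht0 u v
      rw [hRic] at h1 h2
      have h3 : ((m : ℝ) - 1) * g x u v ≠ 0 := mul_ne_zero (by linarith) huv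
      have h4 : (a r - a t) * k = ε * (deriv (deriv a) r - deriv (deriv a) t) := by
        apply mul_left_cancel₀ h3
        linear_combination h1 - h2
      linear_combination -ε * h4 - (deriv (deriv a) r - deriv (deriv a) t) * hε2
    · have h2 := eqn t ht x ht0 u v
      rw [hRic] at h2
      apply mul_left_cancel₀ (show (m : ℝ) - 1 ≠ 0 by linarith)
      linear_combination h2
  choose k c hode hRic ψ hψ using hpt
  have hconst : ∀ x y, k x = k y ∧ c x = c y := by
    intro x y
    obtain ⟨t, ht, s, hs, hts, ht', hs'⟩ :=
      exists_two_values hJc haC.continuousOn hac (Set.toFinite {-b x, -b y})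
    simp only [Set.mem_insert_iff, Set.mem_singleton_iff, not_or] at ht' hs'
    have hz : ∀ {p q : ℝ}, p ≠ -q → p + q ≠ 0 := fun h h' => h (by linarith)
    have h1 := (hode x t ht (hz ht'.1)).symm.trans (hode y t ht (hz ht'.2))
    have h2 := (hode x s hs (hz hs'.1)).symm.trans (hode y s hs (hz hs'.2))
    have hk : k x = k y := by
      apply mul_left_cancel₀ (sub_ne_zero.2 hts)
      linear_combination ε * (h1 - h2) - (a t - a s) * (k x - k y) * hε2
    exact ⟨hk, by rw [hk] at h1; linarith⟩
  refine ⟨k x₀, c x₀, fun x u v => ?_, fun t ht => ?_, fun x u v => ?_⟩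
  · rw [hRic x u v, (hconst x x₀).1, hfin]
  · obtain ⟨x, hx⟩ : ∃ x, b x ≠ -a t := by
      by_contra! h
      exact hbc ⟨_, h⟩
    rw [hode x t ht fun h => hx (by linarith), (hconst x x₀).1, (hconst x x₀).2]
  · rw [PseudoRiem.laplacian_of_hessian_eq (hg.nondegenerate x) (hψ x), hfin, hψ x u v,
      mul_div_cancel_right₀ _ (by linarith : (m : ℝ) ≠ 0)]
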